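/- Let $X$ be a random variable whose distribution is parameterized by $\theta\in\Theta$ and has, under the parameter value $\theta$, a probability density (or mass) function $f(\cdot;\theta)$ (all with respect to a common reference measure). Let $X_1,X_2,\dots$ be i.i.d. samples of $X$, write $f_n(x_1,\dots,x_n;\theta)=\prod_{i=1}^n f(x_i;\theta)$ for the joint density (or mass) function of $(X_1,\dots,X_n)$, and let $\Pr\{\,\cdot\mid\theta\}$ denote probability under the parameter value $\theta$. For $\theta',\theta''\in\Theta$ and $b,c>0$, let $b<\Upsilon_n(\theta',\theta'')<c$ denote the event $$b\,f_n(X_1,\dots,X_n;\theta')<f_n(X_1,\dots,X_n;\theta'')<c\,f_n(X_1,\dots,X_n;\theta'),$$ so that $\Upsilon_n(\theta',\theta'')$ is the likelihood ratio $f_n(X_1,\dots,X_n;\theta'')/f_n(X_1,\dots,X_n;\theta')$ whenever the denominator is non-zero. Let $\theta,\theta',\theta''\in\Theta$. Assume that $\Pr\{f(X;\theta')f(X;\theta'')=0\mid\theta\}=0$ and that, under $\theta$, the variance of $\ln\frac{f(X;\theta'')}{f(X;\theta')}$ is positive and finite. Then, for all $\alpha,\beta\in(0,1)$, $$\lim_{n\to\infty}\Pr\Big\{\beta<\Upsilon_n(\theta',\theta'')<\frac1\alpha\;\Big|\;\theta\Big\}=0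 .$$ -/

import Mathlib

open MeasureTheory ProbabilityTheory Filter
open scoped Topology ENNReal

/-- `S 0, S 1, …` are i.i.d. samples of the random variable `X`, whose distribution is
parameterized by `θ : Θ`: under `P θ`, the law of `X` has density `f θ` with respect to the
reference measure `ν`. Lebesgue measure as `ν` gives probability density functions, counting
measure gives probability mass functions. -/
structure IsIIDSampleModel {Θ Ω 𝓧 : Type*} [MeasurableSpace Ω] [MeasurableSpace 𝓧]
    (ν : Measure 𝓧) (f : Θ → 𝓧 → ℝ) (P : Θ → Measure Ω)
    (X : Ω → 𝓧) (S : ℕ → Ω → 𝓧) : Prop where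
  isProbabilityMeasure : ∀ θ, IsProbabilityMeasure (P θ)
  density_nonneg : ∀ θ x, 0 ≤ f θ x
  density_measurable : ∀ θ, Measurable (f θ)
  measurable_X : Measurable X
  measurable_S : ∀ i, Measurable (S i)
  law_X : ∀ θ, (P θ).map X = ν.withDensity (fun x => ENNReal.ofReal (f θ x))
  identDistrib : ∀ θ i, IdentDistrib (S i) X (P θ) (P θ)
  indep : ∀ θ, iIndepFun S (P θ)

/-- The joint density (or mass function) `f_n (x_1, …, x_n; θ)` of `n` i.i.d. samples, each with
density (or mass function) `f (·; θ)`. -/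
noncomputable def jointDensity {Θ 𝓧 : Type*} (f : Θ → 𝓧 → ℝ) (n : ℕ) (x : Fin n → 𝓧) (θ : Θ) : ℝ :=
  ∏ i, f θ (x i)

/-- The relation `b < Υ_n (x; θ', θ'') < c` between the likelihood ratio and the numbers `b`, `c`.
It is expressed without division, so it is meaningful also where `f_n (x; θ') = 0`. -/
def LikelihoodRatioBetween {Θ 𝓧 : Type*} (f : Θ → 𝓧 → ℝ) (n : ℕ) (x : Fin n → 𝓧) (θ' θ'' : Θ)
    (b c : ℝ) : Prop :=
  b * jointDensity f n x θ' < jointDensity f n x θ'' ∧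
    jointDensity f n x θ'' < c * jointDensity f n x θ'

/-! Let `φ` be the characteristic function of the log-likelihood ratio of a single sample and `γ`
the standard Gaussian measure. By Fubini, `E[exp (-Sₙ² / 2)] = ∫ φⁿ dγ` for the log-likelihood
ratio `Sₙ` of `n` samples, so the probability that `Sₙ` lies in a fixed bounded set is at most a
constant times `∫ |φ|ⁿ dγ`. As the log-likelihood ratio is not almost surely constant, `|φ| < 1`
almost everywhere, and the integral tends to zero by dominated convergence. -/

lemma integral_charFun_comm {E : Type*} [NormedAddCommGroup E] [InnerProductSpace ℝ E]
    [SecondCountableTopology E] [MeasurableSpace E] [OpensMeasurableSpace E]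
    (μ ν : Measure E) [IsFiniteMeasure μ] [IsFiniteMeasure ν] :
    ∫ t, charFun μ t ∂ν = ∫ x, charFun ν x ∂μ := by
  have hint : Integrable (fun p : E × E => Complex.exp (inner ℝ p.2 p.1 * Complex.I))
      (ν.prod μ) :=
    .of_bound (by fun_prop) 1 (.of_forall fun p => (Complex.norm_exp_ofReal_mul_I _).le)
  simp only [charFun_apply]
  rw [integral_integral_swap hint]
  simp only [real_inner_comm]

lemma integral_exp_neg_sq_div_two_le_integral_norm_charFun (μ : Measure ℝ) [IsFiniteMeasure μ] :
    ∫ x, Real.exp (-x ^ 2 / 2) ∂μ ≤ ∫ t, ‖charFun μ t‖ ∂gaussianReal 0 1 := by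
  have hcharFun (x : ℝ) :
      charFun (gaussianReal 0 1) x = (Real.exp (-x ^ 2 / 2) : ℂ) := by
    simp [charFun_gaussianReal, neg_div]
  have hcomm := integral_charFun_comm μ (gaussianReal 0 1)
  simp only [hcharFun, integral_complex_ofReal] at hcomm
  calc ∫ x, Real.exp (-x ^ 2 / 2) ∂μ
      ≤ ‖∫ t, charFun μ t ∂gaussianReal 0 1‖ := by
        rw [hcomm, Complex.norm_real]
        exact le_abs_self _
    _ ≤ ∫ t, ‖charFun μ t‖ ∂gaussianReal 0 1 := norm_integral_le_integral_norm _

lemma measureReal_abs_le_le_integral_norm_charFun (μ : Measure ℝ) [IsFiniteMeasure μ] (C : ℝ) :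
    μ.real {x | |x| ≤ C} ≤ Real.exp (C ^ 2 / 2) * ∫ t, ‖charFun μ t‖ ∂gaussianReal 0 1 := by
  have hint : Integrable (fun x : ℝ => Real.exp (-x ^ 2 / 2)) μ := by
    refine .of_bound (by fun_prop) 1 (.of_forall fun x => ?_)
    rw [Real.norm_eq_abs, Real.abs_exp, Real.exp_le_one_iff]
    nlinarith [sq_nonneg x]
  have hsubset : {x : ℝ | |x| ≤ C} ⊆ {x | Real.exp (-C ^ 2 / 2) ≤ Real.exp (-x ^ 2 / 2)} := by
    intro x (hx : |x| ≤ C)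
    have hsq : x ^ 2 ≤ C ^ 2 := sq_le_sq' (abs_le.1 hx).1 (abs_le.1 hx).2
    exact Real.exp_le_exp.2 (by linarith)
  have hmarkov : Real.exp (-C ^ 2 / 2) * μ.real {x | |x| ≤ C} ≤ ∫ x, Real.exp (-x ^ 2 / 2) ∂μ :=
    (mul_le_mul_of_nonneg_left (measureReal_mono hsubset) (Real.exp_nonneg _)).trans
      (mul_meas_ge_le_integral_of_nonneg (.of_forall fun _ => Real.exp_nonneg _) hint _)
  calc μ.real {x | |x| ≤ C}
      = Real.exp (C ^ 2 / 2) * (Real.exp (-C ^ 2 / 2) * μ.real {x | |x| ≤ C}) := by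
        rw [← mul_assoc, ← Real.exp_add, neg_div, add_neg_cancel, Real.exp_zero, one_mul]
    _ ≤ Real.exp (C ^ 2 / 2) * ∫ t, ‖charFun μ t‖ ∂gaussianReal 0 1 := by
        gcongr
        exact hmarkov.trans (integral_exp_neg_sq_div_two_le_integral_norm_charFun μ)

lemma ae_exp_inner_eq_charFun_of_norm_charFun_eq_one {E : Type*} [NormedAddCommGroup E]
    [InnerProductSpace ℝ E] [MeasurableSpace E] {μ : Measure E} [IsProbabilityMeasure μ] {t : E}
    (ht : ‖charFun μ t‖ = 1) :
    ∀ᵐ x ∂μ, Complex.exp (inner ℝ x t * Complex.I) = charFun μ t := by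
  have hnorm : ∀ᵐ x ∂μ, ‖Complex.exp (inner ℝ x t * Complex.I)‖ ≤ 1 :=
    .of_forall fun x => (Complex.norm_exp_ofReal_mul_I _).le
  rcases ae_eq_const_or_norm_integral_lt_of_norm_le_const hnorm with hconst | hlt
  · rwa [average_eq_integral] at hconst
  · rw [← charFun_apply, ht] at hlt
    simp at hlt

lemma countable_setOf_exp_mul_I_eq {x y : ℝ} (hxy : x ≠ y) :
    {t : ℝ | Complex.exp (t * x * Complex.I) = Complex.exp (t * y * Complex.I)}.Countable := by
  refine (Set.countable_range fun k : ℤ => k * (2 * Real.pi) / (x - y)).mono fun t ht => ?_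
  obtain ⟨k, hk⟩ := Complex.exp_eq_exp_iff_exists_int.1 ht
  have hk' : ((t * x : ℝ) : ℂ) = (t * y + k * (2 * Real.pi) : ℝ) :=
    mul_right_cancel₀ Complex.I_ne_zero (by push_cast; linear_combination hk)
  have hk'' : t * x = t * y + k * (2 * Real.pi) := by exact_mod_cast hk'
  exact ⟨k, (div_eq_iff (sub_ne_zero.2 hxy)).2 (by linear_combination -hk'')⟩

lemma ae_norm_charFun_lt_one {μ : Measure ℝ} [IsProbabilityMeasure μ]
    (hμ : ¬(ae μ).Subsingleton) (ν : Measure ℝ) [SFinite ν] [NullSingletonClass ν] :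
    ∀ᵐ t ∂ν, ‖charFun μ t‖ < 1 := by
  have hmeas : MeasurableSet {p : ℝ × ℝ | ‖charFun μ p.1‖ = 1 →
      Complex.exp (p.1 * p.2 * Complex.I) = charFun μ p.1} := by
    have hcharFun : Measurable fun p : ℝ × ℝ => charFun μ p.1 :=
      measurable_charFun.comp measurable_fst
    exact .imp (measurableSet_eq_fun hcharFun.norm measurable_const)
      (measurableSet_eq_fun (by fun_prop) hcharFun)
  have hae : ∀ᵐ x : ℝ ∂μ, ∀ᵐ t : ℝ ∂ν, ‖charFun μ t‖ = 1 →
      Complex.exp (t * x * Complex.I) = charFun μ t := by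
    refine (Measure.ae_ae_comm hmeas).1 (.of_forall fun t => ?_)
    by_cases ht : ‖charFun μ t‖ = 1
    · filter_upwards [ae_exp_inner_eq_charFun_of_norm_charFun_eq_one ht] with x hx _
      simpa using hx
    · exact .of_forall fun x h => absurd h ht
  -- Almost every `t` with `‖charFun μ t‖ = 1` gives `x` and `y` the same phase, which happens for
  -- countably many `t` only.
  obtain ⟨x, hx, y, hy, hxy⟩ := Set.not_subsingleton_iff.1 fun h => hμ ⟨_, hae, h⟩
  filter_upwards [hx, hy, (countable_setOf_exp_mul_I_eq hxy).ae_notMem ν] with t htx hty ht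
  exact (norm_charFun_le_one t).lt_of_ne fun h => ht ((htx h).trans (hty h).symm)

lemma tendsto_integral_norm_charFun_pow {μ : Measure ℝ} [IsProbabilityMeasure μ]
    (hμ : ¬(ae μ).Subsingleton) (ν : Measure ℝ) [IsFiniteMeasure ν] [NullSingletonClass ν] :
    Tendsto (fun n : ℕ => ∫ t, ‖charFun μ t‖ ^ n ∂ν) atTop (𝓝 0) := by
  have hlim : ∀ᵐ t ∂ν, Tendsto (fun n : ℕ => ‖charFun μ t‖ ^ n) atTop (𝓝 0) := by
    filter_upwards [ae_norm_charFun_lt_one hμ ν] with t ht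
    exact tendsto_pow_atTop_nhds_zero_of_lt_one (norm_nonneg _) ht
  simpa using tendsto_integral_of_dominated_convergence (fun _ => (1 : ℝ))
    (fun n => (measurable_charFun.norm.pow_const n).aestronglyMeasurable) (integrable_const 1)
    (fun n => .of_forall fun t => by
      simpa using pow_le_one₀ (norm_nonneg _) (norm_charFun_le_one t)) hlim

section PartialSums

variable {Ω : Type*} [MeasurableSpace Ω] {P : Measure Ω}

lemma charFun_map_sum_eq_pow {ι E : Type*} [NormedAddCommGroup E] [InnerProductSpace ℝ E]
    [SecondCountableTopology E] [MeasurableSpace E] [BorelSpace E] {Y : ι → Ω → E} {μ : Measure E}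
    (hindep : iIndepFun Y P) (hlaw : ∀ i, HasLaw (Y i) μ P) (s : Finset ι) (t : E) :
    charFun (P.map fun ω => ∑ i ∈ s, Y i ω) t = charFun μ t ^ s.card := by
  rw [(hindep.restrict s).charFun_map_fun_finsetSum_eq_prod fun i _ => (hlaw i).aemeasurable]
  simp [(hlaw _).map_eq]

lemma tendsto_measure_sum_mem_of_isBounded {Y : ℕ → Ω → ℝ} {μ : Measure ℝ}
    (hindep : iIndepFun Y P) (hlaw : ∀ i, HasLaw (Y i) μ P) (hμ : ¬(ae μ).Subsingleton)
    {s : Set ℝ} (hs : Bornology.IsBounded s) :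
    Tendsto (fun n : ℕ => P {ω | ∑ i ∈ Finset.range n, Y i ω ∈ s}) atTop (𝓝 0) := by
  have := hindep.isProbabilityMeasure
  have := (hlaw 0).isProbabilityMeasure_iff.1 inferInstance
  have := nullSingletonClass_gaussianReal (μ := 0) one_ne_zero
  obtain ⟨C, hC⟩ := hs.exists_norm_le
  have hbound (n : ℕ) : P.real {ω | ∑ i ∈ Finset.range n, Y i ω ∈ s} ≤
      Real.exp (C ^ 2 / 2) * ∫ t, ‖charFun μ t‖ ^ n ∂gaussianReal 0 1 := by
    have hsum : AEMeasurable (fun ω => ∑ i ∈ Finset.range n, Y i ω) P :=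
      Finset.aemeasurable_fun_sum _ fun i _ => (hlaw i).aemeasurable
    have := Measure.isProbabilityMeasure_map hsum
    calc P.real {ω | ∑ i ∈ Finset.range n, Y i ω ∈ s}
        ≤ P.real {ω | |∑ i ∈ Finset.range n, Y i ω| ≤ C} :=
          measureReal_mono fun ω hω => hC _ hω
      _ = (P.map fun ω => ∑ i ∈ Finset.range n, Y i ω).real {x | |x| ≤ C} :=
          (map_measureReal_apply_of_aemeasurable hsum
            (measurableSet_le continuous_abs.measurable measurable_const)).symm
      _ ≤ Real.exp (C ^ 2 / 2) * ∫ t, ‖charFun μ t‖ ^ n ∂gaussianReal 0 1 := by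
          simpa only [charFun_map_sum_eq_pow hindep hlaw, norm_pow, Finset.card_range] using
            measureReal_abs_le_le_integral_norm_charFun
              (P.map fun ω => ∑ i ∈ Finset.range n, Y i ω) C
  refine (ENNReal.tendsto_toReal_zero_iff fun n => measure_ne_top _ _).1 ?_
  exact squeeze_zero (fun n => measureReal_nonneg) hbound
    (by simpa using (tendsto_integral_norm_charFun_pow hμ _).const_mul (Real.exp (C ^ 2 / 2)))

lemma not_subsingleton_ae_map_of_evariance_pos [IsProbabilityMeasure P] {Y : Ω → ℝ}
    (hY : AEMeasurable Y P) (hvar : 0 < evariance Y P) : ¬(ae (P.map Y)).Subsingleton := by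
  rintro ⟨s, hs, hsub⟩
  have hYs : ∀ᵐ ω ∂P, Y ω ∈ s := ae_of_ae_map hY hs
  obtain ⟨ω₀, hω₀⟩ := hYs.exists
  have hconst : Y =ᵐ[P] fun _ => Y ω₀ := hYs.mono fun ω hω => hsub hω hω₀
  refine hvar.ne' ((evariance_eq_zero_iff hY).2 ?_)
  simpa [integral_congr_ae hconst] using hconst

end PartialSums

section LikelihoodRatio

variable {Θ 𝓧 : Type*} {f : Θ → 𝓧 → ℝ} {θ' θ'' : Θ}

lemma jointDensity_pos {n : ℕ} {x : Fin n → 𝓧} {θ : Θ} (h : ∀ i, 0 < f θ (x i)) :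
    0 < jointDensity f n x θ :=
  Finset.prod_pos fun i _ => h i

lemma log_jointDensity_div_jointDensity {n : ℕ} {x : Fin n → 𝓧} (h' : ∀ i, 0 < f θ' (x i))
    (h'' : ∀ i, 0 < f θ'' (x i)) :
    Real.log (jointDensity f n x θ'' / jointDensity f n x θ') =
      ∑ i, Real.log (f θ'' (x i) / f θ' (x i)) := by
  rw [jointDensity, jointDensity, ← Finset.prod_div_distrib, Real.log_prod]
  exact fun i _ => (div_pos (h'' i) (h' i)).ne'

lemma LikelihoodRatioBetween.sum_log_mem_Ioo {n : ℕ} {x : Fin n → 𝓧} {b c : ℝ}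
    (h : LikelihoodRatioBetween f n x θ' θ'' b c) (h' : ∀ i, 0 < f θ' (x i))
    (h'' : ∀ i, 0 < f θ'' (x i)) (hb : 0 < b) :
    ∑ i, Real.log (f θ'' (x i) / f θ' (x i)) ∈ Set.Ioo (Real.log b) (Real.log c) := by
  have hpos' := jointDensity_pos h'
  rw [← log_jointDensity_div_jointDensity h' h'']
  exact ⟨Real.log_lt_log hb ((lt_div_iff₀ hpos').2 h.1),
    Real.log_lt_log (div_pos (jointDensity_pos h'') hpos') ((div_lt_iff₀ hpos').2 h.2)⟩

lemma IsIIDSampleModel.ae_forall_density_pos {Ω : Type*} [MeasurableSpace Ω] [MeasurableSpace 𝓧]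
    {ν : Measure 𝓧} {P : Θ → Measure Ω} {X : Ω → 𝓧} {S : ℕ → Ω → 𝓧}
    (hmodel : IsIIDSampleModel ν f P X S) {θ : Θ}
    (hne : P θ {ω | f θ' (X ω) * f θ'' (X ω) = 0} = 0) :
    ∀ᵐ ω ∂P θ, ∀ i, 0 < f θ' (S i ω) ∧ 0 < f θ'' (S i ω) := by
  refine ae_all_iff.2 fun i => ?_
  have hX : ∀ᵐ ω ∂P θ, f θ' (X ω) * f θ'' (X ω) ≠ 0 :=
    ae_iff.2 (by simpa only [not_not] using hne)
  have hS : ∀ᵐ ω ∂P θ, f θ' (S i ω) * f θ'' (S i ω) ≠ 0 :=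
    (hmodel.identDistrib θ i).symm.ae_snd (p := fun y => f θ' y * f θ'' y ≠ 0)
      ((hmodel.density_measurable θ').mul (hmodel.density_measurable θ'')
        (measurableSet_singleton 0).compl) hX
  filter_upwards [hS] with ω hω
  exact ⟨(hmodel.density_nonneg _ _).lt_of_ne' (left_ne_zero_of_mul hω),
    (hmodel.density_nonneg _ _).lt_of_ne' (right_ne_zero_of_mul hω)⟩

end LikelihoodRatio

theorem theorem6_general {Θ Ω 𝓧 : Type*} [MeasurableSpace Ω] [MeasurableSpace 𝓧]
    (ν : Measure 𝓧) (f : Θ → 𝓧 → ℝ) (P : Θ → Measure Ω)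
    (X : Ω → 𝓧) (S : ℕ → Ω → 𝓧) (hmodel : IsIIDSampleModel ν f P X S)
    (θ θ' θ'' : Θ)
    (hne : P θ {ω | f θ' (X ω) * f θ'' (X ω) = 0} = 0)
    (hvar_pos : 0 < evariance (fun ω => Real.log (f θ'' (X ω) / f θ' (X ω))) (P θ))
    (b c : ℝ) (hb : 0 < b) :
    Tendsto
      (fun n : ℕ => P θ {ω | LikelihoodRatioBetween f n (fun i => S i ω) θ' θ'' b c})
      atTop (𝓝 0) := by
  have := hmodel.isProbabilityMeasure θ
  let g : 𝓧 → ℝ := fun y => Real.log (f θ'' y / f θ' y)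
  have hg : Measurable g :=
    ((hmodel.density_measurable θ'').div (hmodel.density_measurable θ')).log
  have hlaw (i : ℕ) : HasLaw (fun ω => g (S i ω)) ((P θ).map fun ω => g (X ω)) (P θ) :=
    ⟨(hg.comp (hmodel.measurable_S i)).aemeasurable,
      ((hmodel.identDistrib θ i).comp hg).map_eq⟩
  have hsum := tendsto_measure_sum_mem_of_isBounded
    ((hmodel.indep θ).comp (fun _ => g) fun _ => hg) hlaw
    (not_subsingleton_ae_map_of_evariance_pos (hg.comp hmodel.measurable_X).aemeasurable hvar_pos)
    (Metric.isBounded_Ioo (Real.log b) (Real.log c))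
  refine tendsto_of_tendsto_of_tendsto_of_le_of_le tendsto_const_nhds hsum
    (fun _ => zero_le) fun n => measure_mono_ae ?_
  filter_upwards [hmodel.ae_forall_density_pos hne] with ω hpos hbetween
  have hmem := hbetween.sum_log_mem_Ioo (fun i => (hpos i).1) (fun i => (hpos i).2) hb
  rwa [Fin.sum_univ_eq_sum_range (fun i => g (S i ω))] at hmem

theorem theorem6 {Θ Ω 𝓧 : Type*} [MeasurableSpace Ω] [MeasurableSpace 𝓧]
    (ν : Measure 𝓧) (f : Θ → 𝓧 → ℝ) (P : Θ → Measure Ω)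
    (X : Ω → 𝓧) (S : ℕ → Ω → 𝓧) (hmodel : IsIIDSampleModel ν f P X S)
    (θ θ' θ'' : Θ)
    (hne : P θ {ω | f θ' (X ω) * f θ'' (X ω) = 0} = 0)
    (hvar_pos : 0 < evariance (fun ω => Real.log (f θ'' (X ω) / f θ' (X ω))) (P θ))
    (hvar_fin : evariance (fun ω => Real.log (f θ'' (X ω) / f θ' (X ω))) (P θ) < ⊤)
    (α β : ℝ) (hα : α ∈ Set.Ioo (0 : ℝ) 1) (hβ : β ∈ Set.Ioo (0 : ℝ) 1) :
    Tendsto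
      (fun n : ℕ => P θ {ω | LikelihoodRatioBetween f n (fun i => S i ω) θ' θ'' β (1 / α)})
      atTop (𝓝 0) :=
  theorem6_general ν f P X S hmodel θ θ' θ'' hne hvar_pos β (1 / α) hβ.1
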